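/- Let $k$ be a field, let $s,l,t\ge 1$ be integers, and let $F=k\langle x_1,\dots,x_s\rangle=\bigoplus_{n\ge 0}F_n$ be the free associative algebra with its standard grading ($\deg x_i=1$). Let $\alpha\subset F_l$ be a set of exactly $t$ homogeneous elements of degree $l$ which is a minimal system of generators of the two-sided ideal $\mathrm{id}(\alpha)$ (no proper subset of $\alpha$ generates the same two-sided ideal). Let $R=F/\mathrm{id}(\alpha)$ with the induced grading, $a_n=\dim_k R_n$, and $R(x)=\sum_{n\ge 0}a_nx^n$. A non-empty minimal set $\beta$ of homogeneous relations, having $u_n$ elements of degree $n$ and $u(x)=\sum_n u_nx^n$, is called strongly free if equality holds in the Golod--Shafarevich inequality $(F/\mathrm{id}(\beta))(x)\,(1-sx+u(x))\ge 1$, that is, if $$(F/\mathrm{id}(\beta))(x)\,(1-sx+u(x))=1$$ as formal power series, where $(F/\mathrm{id}(\beta))(x)$ is the Hilbert series. Then the series $R(x)$ converges at $x=s^{-1}$, and the following conditions are equivalent: (i) the set $\alpha$ is strongly free; (ii) equality holds in Govorov's inequality $t\ge s^l/R(s^{-1})$, that is, $\displaystyle t=\frac{s^l}{R(s^{-1})}$;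 (iii) equality holds in Govorov's inequality $t\ge (s a_{n-1}-a_n)/a_{n-l}$ for all possible $n$, that is, $\displaystyle t=\frac{s a_{n-1}-a_n}{a_{n-l}}$ for every $n\ge l$ with $a_{n-l}\ne 0$. -/

import Mathlib

namespace GolodShafarevich

/-- The homogeneous component `F_n` of the free associative algebra `F = k⟨x_1, …, x_s⟩` in its
standard grading (`deg x_i = 1`): the span of all words of length `n` in the generators. -/
def homogeneousPart (k : Type*) [Field k] (s n : ℕ) : Submodule k (FreeAlgebra k (Fin s)) :=
  Submodule.span k {w | ∃ v : Fin n → Fin s, w = (List.ofFn fun i => FreeAlgebra.ι k (v i)).prod}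

variable {k : Type*} [Field k] {s : ℕ}

/-- The quotient algebra `R = F / id(α)` by the two-sided ideal generated by `α`. -/
abbrev QuotientAlgebra (α : Set (FreeAlgebra k (Fin s))) : Type _ :=
  (TwoSidedIdeal.span α).ringCon.Quotient

/-- The canonical projection `F → R = F / id(α)`. -/
def proj (α : Set (FreeAlgebra k (Fin s))) : FreeAlgebra k (Fin s) →ₐ[k] QuotientAlgebra α :=
  (TwoSidedIdeal.span α).ringCon.mkₐ k

/-- The component `R_n` of `R = F / id(α)` in the induced grading: the image of `F_n`. -/
def quotientPart (α : Set (FreeAlgebra k (Fin s))) (n : ℕ) : Submodule k (QuotientAlgebra α) :=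
  (homogeneousPart k s n).map (proj α).toLinearMap

/-- The dimension `a_n = dim R_n`, where `R = F / id(α)`. -/
noncomputable def dimPart (α : Set (FreeAlgebra k (Fin s))) (n : ℕ) : ℕ :=
  Module.finrank k (quotientPart α n)

/-- The Hilbert series `R(x) = ∑ a_n x^n` of `R = F / id(α)`, as a formal power series. -/
noncomputable def hilbertSeries (α : Set (FreeAlgebra k (Fin s))) : PowerSeries ℤ :=
  PowerSeries.mk fun n => (dimPart α n : ℤ)

/-- The generating function `u(x) = ∑ u_n x^n` of a set of nonzero homogeneous elements: `u_n` is
the number of its elements of degree `n`. -/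
noncomputable def genFun (α : Set (FreeAlgebra k (Fin s))) : PowerSeries ℤ :=
  PowerSeries.mk fun n => ((α ∩ (homogeneousPart k s n : Set (FreeAlgebra k (Fin s)))).ncard : ℤ)

/-- `α` is a minimal system of generators of the two-sided ideal `id(α)`: no proper subset of `α`
generates the same ideal. -/
def IsMinimalGenerating (α : Set (FreeAlgebra k (Fin s))) : Prop :=
  ∀ β : Set (FreeAlgebra k (Fin s)), β ⊂ α → TwoSidedIdeal.span β ≠ TwoSidedIdeal.span α

/-- A minimal set `α` of homogeneous relations is strongly free if it is non-empty and equality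
holds in the Golod--Shafarevich inequality `R(x) (1 - s x + u(x)) ≥ 1`. -/
def StronglyFree (α : Set (FreeAlgebra k (Fin s))) : Prop :=
  α.Nonempty ∧ hilbertSeries α * (1 - (s : PowerSeries ℤ) * PowerSeries.X + genFun α) = 1

end GolodShafarevich

/-!
Write `aₙ` for the dimension of the component of degree `n` of `R = F / id(α)`. All three conditions
say that Govorov's inequality `s a_{n-1} ≤ a_n + t a_{n-l}` is an equality for every `n ≥ l`.

The inequality (`mul_dimPart_le`) comes from the decomposition `I = I x₁ + ⋯ + I xₛ + F α` of the
ideal `I = id(α)`: modulo the first summands, the coefficients of the elements of `α` matter only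
modulo `I`, so `dim Iₙ ≤ s dim Iₙ₋₁ + t aₙ₋ₗ`. Moreover `R` agrees with the free algebra below
degree `l` (`dimPart_of_lt`).

Convergence at `s⁻¹`: the dimensions are submultiplicative (`dimPart_add_le`) and `aₗ < s ^ l`, as
`α` contains a nonzero element, so `bₙ = aₙ s⁻ⁿ` satisfies `bₙ₊ₗ ≤ bₗ bₙ` with `bₗ < 1`
(`summable_of_submultiplicative`).

In degrees `n ≥ l` the coefficients of `R(x) (1 - s x + t x ^ l)` are the defects of Govorov's
inequality, and in lower degrees they are those of `1`, which settles strong freeness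
(`mk_mul_eq_one_iff`). Weighted by `s⁻ⁿ` the defects sum to `t s⁻ˡ R(s⁻¹) - 1`, because `bₙ₋₁ - bₙ`
telescopes and `bₙ` tends to zero; a sum of nonnegative terms vanishes only if every term does
(`eq_div_tsum_iff`). Finally, `aₙ₋ₗ = 0` forces `aₙ₋₁ = aₙ = 0`, so that the degrees excluded
from the third condition carry no information (`forall_eq_div_iff`).
-/

namespace GolodShafarevich

section Algebra

variable {k : Type*} [Field k] {s : ℕ}

/-! ### Words and the grading of the free algebra -/

/-- The monomial of the free algebra spelled by a list of letters. -/
def word (k : Type*) [Field k] {s : ℕ} (u : List (Fin s)) : FreeAlgebra k (Fin s) :=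
  (u.map (FreeAlgebra.ι k)).prod

@[simp]
lemma word_nil : word k ([] : List (Fin s)) = 1 := by simp [word]

lemma word_append (u v : List (Fin s)) : word k (u ++ v) = word k u * word k v := by
  simp [word]

lemma basisFreeMonoid_ofList (u : List (Fin s)) :
    FreeAlgebra.basisFreeMonoid k (Fin s) (FreeMonoid.ofList u) = word k u := by
  simp [FreeAlgebra.basisFreeMonoid, FreeAlgebra.equivMonoidAlgebraFreeMonoid,
    FreeMonoid.lift_apply, word]

lemma span_range_word : Submodule.span k (Set.range (word k (s := s))) = ⊤ := by
  rw [← (FreeAlgebra.basisFreeMonoid k (Fin s)).span_eq]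
  congr 1
  ext x
  constructor
  · rintro ⟨u, rfl⟩
    exact ⟨FreeMonoid.ofList u, basisFreeMonoid_ofList u⟩
  · rintro ⟨u, rfl⟩
    exact ⟨FreeMonoid.toList u, (basisFreeMonoid_ofList _).symm⟩

lemma homogeneousPart_eq_span_range (n : ℕ) :
    homogeneousPart k s n =
      Submodule.span k (Set.range fun v : Fin n → Fin s => word k (List.ofFn v)) := by
  unfold homogeneousPart word
  congr 1
  ext x
  simp only [Set.mem_ofPred_eq, Set.mem_range, List.map_ofFn, Function.comp_def, eq_comm]

lemma homogeneousPart_eq_span_image (n : ℕ) :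
    homogeneousPart k s n = Submodule.span k (word k '' {u | u.length = n}) := by
  rw [homogeneousPart_eq_span_range]
  congr 1
  ext x
  constructor
  · rintro ⟨v, rfl⟩
    exact ⟨List.ofFn v, by simp, rfl⟩
  · rintro ⟨u, rfl, rfl⟩
    exact ⟨u.get, by simp⟩

lemma word_mem_homogeneousPart (u : List (Fin s)) :
    word k u ∈ homogeneousPart k s u.length := by
  rw [homogeneousPart_eq_span_image]
  exact Submodule.subset_span ⟨u, rfl, rfl⟩

lemma homogeneousPart_add (m n : ℕ) :
    homogeneousPart k s (m + n) = homogeneousPart k s m * homogeneousPart k s n := by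
  simp only [homogeneousPart_eq_span_image, Submodule.span_mul_span]
  congr 1
  ext x
  constructor
  · rintro ⟨u, hu, rfl⟩
    have hu : u.length = m + n := hu
    refine ⟨_, ⟨u.take m, by simp; omega, rfl⟩, _, ⟨u.drop m, by simp; omega, rfl⟩, ?_⟩
    simp [← word_append]
  · rintro ⟨_, ⟨u, hu, rfl⟩, _, ⟨v, hv, rfl⟩, rfl⟩
    have hu : u.length = m := hu
    have hv : v.length = n := hv
    exact ⟨u ++ v, by simp [hu, hv], word_append u v⟩

instance (n : ℕ) : Module.Finite k (homogeneousPart k s n) := by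
  rw [homogeneousPart_eq_span_range]
  exact FiniteDimensional.span_of_finite k (Set.finite_range _)

lemma finrank_homogeneousPart (n : ℕ) : Module.finrank k (homogeneousPart k s n) = s ^ n := by
  have h : LinearIndependent k (fun v : Fin n → Fin s => word k (List.ofFn v)) := by
    simp only [← basisFreeMonoid_ofList]
    exact (FreeAlgebra.basisFreeMonoid k (Fin s)).linearIndependent.comp
      (fun v : Fin n → Fin s => FreeMonoid.ofList (List.ofFn v))
      (fun u v h => List.ofFn_injective (FreeMonoid.ofList.injective h))
  rw [homogeneousPart_eq_span_range, finrank_span_eq_card h]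
  simp

/-- The projection of the free algebra onto its homogeneous component of degree `n`, along the
other components. -/
noncomputable def degreeProj (k : Type*) [Field k] (s n : ℕ) :
    FreeAlgebra k (Fin s) →ₗ[k] FreeAlgebra k (Fin s) :=
  (FreeAlgebra.basisFreeMonoid k (Fin s)).constr k fun u =>
    if (FreeMonoid.toList u).length = n then word k (FreeMonoid.toList u) else 0

lemma degreeProj_word (n : ℕ) (u : List (Fin s)) :
    degreeProj k s n (word k u) = if u.length = n then word k u else 0 := by
  rw [← basisFreeMonoid_ofList, degreeProj, Module.Basis.constr_basis, basisFreeMonoid_ofList]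
  rfl

lemma degreeProj_of_mem {m : ℕ} (n : ℕ) {x : FreeAlgebra k (Fin s)}
    (hx : x ∈ homogeneousPart k s m) : degreeProj k s n x = if m = n then x else 0 := by
  rw [homogeneousPart_eq_span_image] at hx
  induction hx using Submodule.span_induction with
  | mem x hx =>
    obtain ⟨u, rfl, rfl⟩ := hx
    exact degreeProj_word n u
  | zero => simp
  | add x y _ _ hx hy => rw [map_add, hx, hy]; split_ifs <;> simp
  | smul c x _ hx => rw [map_smul, hx]; split_ifs <;> simp

lemma eq_zero_of_mem_homogeneousPart {m n : ℕ} (hmn : m ≠ n) {x : FreeAlgebra k (Fin s)}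
    (hm : x ∈ homogeneousPart k s m) (hn : x ∈ homogeneousPart k s n) : x = 0 := by
  have h := degreeProj_of_mem n hm
  rwa [degreeProj_of_mem n hn, if_pos rfl, if_neg hmn] at h

/-! ### Homogeneous components of the ideal of relations -/

/-- The span of the products `u f v` of degree `n` with `f ∈ α` and `u`, `v` words, the elements of
`α` being counted as having degree `l`. -/
def relationPart (α : Set (FreeAlgebra k (Fin s))) (l n : ℕ) :
    Submodule k (FreeAlgebra k (Fin s)) :=
  Submodule.span k {x | ∃ u v : List (Fin s), ∃ f ∈ α,
    u.length + l + v.length = n ∧ x = word k u * f * word k v}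

variable {α : Set (FreeAlgebra k (Fin s))} {l : ℕ}

lemma relationPart_le_homogeneousPart (hα : ∀ f ∈ α, f ∈ homogeneousPart k s l) (n : ℕ) :
    relationPart α l n ≤ homogeneousPart k s n := by
  refine Submodule.span_le.2 ?_
  rintro _ ⟨u, v, f, hf, rfl, rfl⟩
  rw [SetLike.mem_coe, homogeneousPart_add, homogeneousPart_add]
  exact Submodule.mul_mem_mul (Submodule.mul_mem_mul (word_mem_homogeneousPart u) (hα f hf))
    (word_mem_homogeneousPart v)

lemma proj_eq_zero_iff {x : FreeAlgebra k (Fin s)} :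
    proj α x = 0 ↔ x ∈ TwoSidedIdeal.span α := by
  rw [TwoSidedIdeal.mem_iff, ← RingCon.eq]
  rfl

lemma relationPart_le_ker (n : ℕ) :
    relationPart α l n ≤ LinearMap.ker (proj α).toLinearMap := by
  refine Submodule.span_le.2 ?_
  rintro _ ⟨u, v, f, hf, rfl, rfl⟩
  rw [SetLike.mem_coe, LinearMap.mem_ker, AlgHom.toLinearMap_apply, proj_eq_zero_iff]
  exact TwoSidedIdeal.mul_mem_right _ _ _
    (TwoSidedIdeal.mul_mem_left _ _ _ (TwoSidedIdeal.subset_span hf))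

lemma mul_mul_mem_iSup_relationPart {f : FreeAlgebra k (Fin s)} (hf : f ∈ α)
    (x y : FreeAlgebra k (Fin s)) : x * f * y ∈ ⨆ n, relationPart α l n := by
  have hx : x ∈ Submodule.span k (Set.range (word k (s := s))) := by
    rw [span_range_word]; trivial
  have hy : y ∈ Submodule.span k (Set.range (word k (s := s))) := by
    rw [span_range_word]; trivial
  induction hx using Submodule.span_induction with
  | zero => simp
  | add x x' _ _ hx hx' => rw [add_mul, add_mul]; exact add_mem hx hx'
  | smul c x _ hx => rw [smul_mul_assoc, smul_mul_assoc]; exact Submodule.smul_mem _ c hx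
  | mem x hx =>
    obtain ⟨u, rfl⟩ := hx
    induction hy using Submodule.span_induction with
    | zero => simp
    | add y y' _ _ hy hy' => rw [mul_add]; exact add_mem hy hy'
    | smul c y _ hy => rw [mul_smul_comm]; exact Submodule.smul_mem _ c hy
    | mem y hy =>
      obtain ⟨v, rfl⟩ := hy
      exact Submodule.mem_iSup_of_mem _ (Submodule.subset_span ⟨u, v, f, hf, rfl, rfl⟩)

lemma mem_iSup_relationPart {x : FreeAlgebra k (Fin s)} (hx : x ∈ TwoSidedIdeal.span α) :
    x ∈ ⨆ n, relationPart α l n := by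
  rw [TwoSidedIdeal.mem_span_iff_mem_addSubgroup_closure] at hx
  induction hx using AddSubgroup.closure_induction with
  | mem x hx =>
    obtain ⟨_, ⟨x, -, f, hf, rfl⟩, y, -, rfl⟩ := hx
    exact mul_mul_mem_iSup_relationPart hf x y
  | zero => exact zero_mem _
  | add x y _ _ hx hy => exact add_mem hx hy
  | neg x _ hx => exact neg_mem hx

/-- The two-sided ideal generated by elements of degree `l` is homogeneous, with components
`relationPart α l n`. -/
lemma mem_relationPart_iff (hα : ∀ f ∈ α, f ∈ homogeneousPart k s l) {n : ℕ}
    {x : FreeAlgebra k (Fin s)} (hx : x ∈ homogeneousPart k s n) :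
    x ∈ relationPart α l n ↔ proj α x = 0 := by
  refine ⟨fun h => relationPart_le_ker n h, fun h => ?_⟩
  have key : ⨆ m, relationPart α l m ≤ (relationPart α l n).comap (degreeProj k s n) := by
    refine iSup_le fun m y hy => ?_
    rw [Submodule.mem_comap, degreeProj_of_mem n (relationPart_le_homogeneousPart hα m hy)]
    split_ifs with hmn
    · exact hmn ▸ hy
    · exact zero_mem _
  simpa [degreeProj_of_mem n hx] using key (mem_iSup_relationPart (proj_eq_zero_iff.1 h))

instance (n : ℕ) : Module.Finite k (quotientPart α n) :=
  inferInstanceAs (Module.Finite k ((homogeneousPart k s n).map (proj α).toLinearMap))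

lemma finite_relationPart (hα : ∀ f ∈ α, f ∈ homogeneousPart k s l) (n : ℕ) :
    Module.Finite k (relationPart α l n) :=
  Submodule.finiteDimensional_of_le (relationPart_le_homogeneousPart hα n)

lemma dimPart_add_finrank_relationPart (hα : ∀ f ∈ α, f ∈ homogeneousPart k s l) (n : ℕ) :
    dimPart α n + Module.finrank k (relationPart α l n) = s ^ n := by
  have h := LinearMap.finrank_range_add_finrank_ker
    ((proj α).toLinearMap.domRestrict (homogeneousPart k s n))
  rw [finrank_homogeneousPart, LinearMap.range_domRestrict] at h
  rw [← h]
  congr 1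
  have hker : (LinearMap.ker ((proj α).toLinearMap.domRestrict (homogeneousPart k s n))).map
      (homogeneousPart k s n).subtype = relationPart α l n := by
    ext x
    constructor
    · rintro ⟨y, hy, rfl⟩
      exact (mem_relationPart_iff hα y.2).2 hy
    · intro hx
      have hx' := relationPart_le_homogeneousPart hα n hx
      exact ⟨⟨x, hx'⟩, (mem_relationPart_iff hα hx').1 hx, rfl⟩
  rw [← hker]
  exact (LinearEquiv.finrank_eq (Submodule.equivSubtypeMap (homogeneousPart k s n)
    (LinearMap.ker ((proj α).toLinearMap.domRestrict (homogeneousPart k s n))))).symm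

/-! ### Inequalities between the dimensions of the components -/

lemma dimPart_of_lt (hα : ∀ f ∈ α, f ∈ homogeneousPart k s l) {n : ℕ} (hn : n < l) :
    dimPart α n = s ^ n := by
  have h : relationPart α l n = ⊥ := by
    refine Submodule.span_eq_bot.2 ?_
    rintro _ ⟨u, v, f, -, h, -⟩
    omega
  have := dimPart_add_finrank_relationPart hα n
  rwa [h, finrank_bot, add_zero] at this

lemma dimPart_lt (hα : ∀ f ∈ α, f ∈ homogeneousPart k s l) {f : FreeAlgebra k (Fin s)}
    (hf : f ∈ α) (hf0 : f ≠ 0) : dimPart α l < s ^ l := by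
  have := finite_relationPart hα l
  have hmem : f ∈ relationPart α l l := Submodule.subset_span ⟨[], [], f, hf, by simp, by simp⟩
  have hpos : 0 < Module.finrank k (relationPart α l l) := by
    refine Module.finrank_pos_iff_exists_ne_zero.2 ⟨⟨f, hmem⟩, ?_⟩
    simpa [Subtype.ext_iff] using hf0
  have := dimPart_add_finrank_relationPart hα l
  omega

lemma dimPart_add_le (α : Set (FreeAlgebra k (Fin s))) (m n : ℕ) :
    dimPart α (m + n) ≤ dimPart α m * dimPart α n := by
  have h : quotientPart α (m + n) = quotientPart α m * quotientPart α n := by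
    rw [quotientPart, homogeneousPart_add, Submodule.map_mul]
    rfl
  unfold dimPart
  rw [h, ← Submodule.mulMap_range, ← Module.finrank_tensorProduct]
  exact LinearMap.finrank_range_le _

lemma dimPart_succ_le (α : Set (FreeAlgebra k (Fin s))) (n : ℕ) :
    dimPart α (n + 1) ≤ s * dimPart α n := by
  refine (dimPart_add_le α n 1).trans ?_
  rw [mul_comm]
  refine Nat.mul_le_mul_right _ ?_
  exact (Submodule.finrank_map_le _ _).trans
    ((finrank_homogeneousPart (k := k) (s := s) 1).trans (pow_one s)).le

/-- Govorov's recursive inequality. A relation of degree `n` is a sum of right multiples `g xᵢ` of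
relations `g` of degree `n - 1` and of products `h f` with `f ∈ α` and `h` of degree `n - l`; as
`g f` is of the first kind for any relation `g`, it suffices to let `h` run over representatives of
the component of degree `n - l` of the quotient. -/
lemma mul_dimPart_le (α : Finset (FreeAlgebra k (Fin s)))
    (hα : ∀ f ∈ (α : Set (FreeAlgebra k (Fin s))), f ∈ homogeneousPart k s l)
    (hl : 1 ≤ l) (m : ℕ) :
    s * dimPart (α : Set (FreeAlgebra k (Fin s))) (m + l - 1) ≤
      dimPart (α : Set (FreeAlgebra k (Fin s))) (m + l) +
        α.card * dimPart (α : Set (FreeAlgebra k (Fin s))) m := by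
  classical
  set A : Set (FreeAlgebra k (Fin s)) := (α : Set (FreeAlgebra k (Fin s))) with hA
  obtain ⟨p, hp⟩ : ∃ p, m + l = p + 1 := ⟨m + l - 1, by omega⟩
  have hfin := finite_relationPart hα p
  rw [hp, Nat.add_sub_cancel]
  -- a linear choice of representatives of the component of degree `m` of the quotient
  obtain ⟨σ, hσ⟩ : ∃ σ : quotientPart A m →ₗ[k] homogeneousPart k s m,
      ∀ r, proj A (σ r) = (r : QuotientAlgebra A) := by
    obtain ⟨σ, hσ⟩ := LinearMap.exists_rightInverse_of_surjective
      ((proj A).toLinearMap.submoduleMap (homogeneousPart k s m))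
      (LinearMap.range_eq_top.2 (LinearMap.submoduleMap_surjective _ _))
    exact ⟨σ, fun r => congrArg Subtype.val (LinearMap.congr_fun hσ r)⟩
  let φ : (Fin s → relationPart A l p) →ₗ[k] FreeAlgebra k (Fin s) :=
    ∑ i, LinearMap.mulRight k (FreeAlgebra.ι k i) ∘ₗ (relationPart A l p).subtype ∘ₗ
      LinearMap.proj i
  let ψ : (α → quotientPart A m) →ₗ[k] FreeAlgebra k (Fin s) :=
    ∑ f : α, LinearMap.mulRight k (f : FreeAlgebra k (Fin s)) ∘ₗ
      (homogeneousPart k s m).subtype ∘ₗ σ ∘ₗ LinearMap.proj f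
  have hφ : ∀ g ∈ relationPart A l p, ∀ i, g * FreeAlgebra.ι k i ∈ LinearMap.range φ := by
    intro g hg i
    refine ⟨Pi.single i ⟨g, hg⟩, ?_⟩
    simp only [φ, LinearMap.sum_apply]
    rw [Finset.sum_eq_single i]
    · simp
    · intro j _ hj
      simp [hj]
    · simp
  have hψ : ∀ r : quotientPart A m, ∀ f ∈ α, (σ r : FreeAlgebra k (Fin s)) * f ∈
      LinearMap.range ψ := by
    intro r f hf
    refine ⟨Pi.single ⟨f, hf⟩ r, ?_⟩
    simp only [ψ, LinearMap.sum_apply]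
    rw [Finset.sum_eq_single ⟨f, hf⟩]
    · simp
    · intro j _ hj
      simp [hj]
    · simp
  -- as `l` is positive, splitting off the last letters of `f` exhibits `g f` as a relation times letters
  have hmul : ∀ g ∈ relationPart A l m, ∀ f ∈ homogeneousPart k s l,
      g * f ∈ LinearMap.range φ := by
    intro g hg f hf
    rw [homogeneousPart_eq_span_image] at hf
    induction hf using Submodule.span_induction with
    | zero => simp
    | add x y _ _ hx hy => rw [mul_add]; exact add_mem hx hy
    | smul c x _ hx => rw [mul_smul_comm]; exact Submodule.smul_mem _ c hx
    | mem x hx =>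
      obtain ⟨w, hw, rfl⟩ := hx
      have hw : w.length = l := hw
      obtain rfl | ⟨w', i, rfl⟩ := List.eq_nil_or_concat' w
      · simp at hw; omega
      · rw [word_append, ← mul_assoc]
        simp only [List.length_append, List.length_cons, List.length_nil] at hw
        have : g * word k w' ∈ relationPart A l p := by
          clear hφ φ
          unfold relationPart at hg
          induction hg using Submodule.span_induction with
          | zero => simp
          | add x y _ _ hx hy => rw [add_mul]; exact add_mem hx hy
          | smul c x _ hx => rw [smul_mul_assoc]; exact Submodule.smul_mem _ c hx
          | mem x hx =>
            obtain ⟨u, v, f, hf, h, rfl⟩ := hx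
            refine Submodule.subset_span ⟨u, v ++ w', f, hf, ?_, ?_⟩
            · rw [List.length_append]; omega
            · rw [word_append, mul_assoc _ (word k v)]
        simpa [word] using hφ _ this i
  have hle : relationPart A l (p + 1) ≤ LinearMap.range φ ⊔ LinearMap.range ψ := by
    refine Submodule.span_le.2 ?_
    rintro _ ⟨u, v, f, hf, h, rfl⟩
    obtain rfl | ⟨v', i, rfl⟩ := List.eq_nil_or_concat' v
    · rw [word_nil, mul_one]
      have hu : u.length = m := by simp at h; omega
      have hum : word k u ∈ homogeneousPart k s m := hu ▸ word_mem_homogeneousPart u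
      let r : quotientPart A m :=
        (proj A).toLinearMap.submoduleMap (homogeneousPart k s m) ⟨word k u, hum⟩
      have hr : proj A (σ r : FreeAlgebra k (Fin s)) = proj A (word k u) := hσ r
      have hdiff : word k u - σ r ∈ relationPart A l m := by
        rw [mem_relationPart_iff hα (sub_mem hum (σ r).2), map_sub, hr, sub_self]
      have := Submodule.add_mem_sup (hmul _ hdiff f (hα f hf)) (hψ r f hf)
      rwa [← add_mul, sub_add_cancel] at this
    · refine Submodule.mem_sup_left ?_
      rw [word_append, ← mul_assoc]
      have : word k u * f * word k v' ∈ relationPart A l p := by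
        refine Submodule.subset_span ⟨u, v', f, hf, ?_, rfl⟩
        simp at h; omega
      simpa [word] using hφ _ this i
  have hrank : Module.finrank k (relationPart A l (p + 1)) ≤
      s * Module.finrank k (relationPart A l p) + α.card * dimPart A m := by
    calc Module.finrank k (relationPart A l (p + 1))
        ≤ Module.finrank k (LinearMap.range φ ⊔ LinearMap.range ψ :
            Submodule k (FreeAlgebra k (Fin s))) := Submodule.finrank_mono hle
      _ ≤ Module.finrank k (LinearMap.range φ) + Module.finrank k (LinearMap.range ψ) :=
          Submodule.finrank_add_le_finrank_add_finrank _ _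
      _ ≤ Module.finrank k (Fin s → relationPart A l p) +
            Module.finrank k (α → quotientPart A m) :=
          add_le_add (LinearMap.finrank_range_le _) (LinearMap.finrank_range_le _)
      _ = s * Module.finrank k (relationPart A l p) + α.card * dimPart A m := by
          simp [Module.finrank_pi_fintype, dimPart]
  have h1 := dimPart_add_finrank_relationPart hα p
  have h2 := dimPart_add_finrank_relationPart hα (p + 1)
  have h3 : s * dimPart A p + s * Module.finrank k (relationPart A l p) = s ^ (p + 1) := by
    rw [← mul_add, h1, pow_succ']
  omega

end Algebra

section Series

/-! ### Numerical consequences of the inequalities -/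

/-- A nonnegative sequence is summable as soon as a shift of it is dominated by a multiple of it
with ratio less than one. -/
lemma summable_of_shift_le {b : ℕ → ℝ} (hb : ∀ n, 0 ≤ b n) {c : ℝ} (hc : c < 1)
    (l : ℕ) (h : ∀ n, b (l + n) ≤ c * b n) : Summable b := by
  refine summable_of_sum_range_le (c := (∑ i ∈ Finset.range l, b i) / (1 - c)) hb fun n => ?_
  rw [le_div_iff₀ (by linarith)]
  have h1 : ∑ i ∈ Finset.range n, b i ≤ ∑ i ∈ Finset.range (l + n), b i :=
    Finset.sum_le_sum_of_subset_of_nonneg (Finset.range_mono (by omega)) fun i _ _ => hb i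
  have h2 : ∑ i ∈ Finset.range n, b (l + i) ≤ c * ∑ i ∈ Finset.range n, b i := by
    rw [Finset.mul_sum]
    exact Finset.sum_le_sum fun i _ => h i
  rw [Finset.sum_range_add] at h1
  linarith

variable {a : ℕ → ℕ} {s l t : ℕ}

lemma summable_of_submultiplicative (hs : 0 < s) (hsub : ∀ m n, a (m + n) ≤ a m * a n)
    (hlt : a l < s ^ l) : Summable fun n => (a n : ℝ) * ((s : ℝ)⁻¹) ^ n := by
  have hs' : (0 : ℝ) < s := by exact_mod_cast hs
  refine summable_of_shift_le (c := (a l : ℝ) * ((s : ℝ)⁻¹) ^ l) (fun n => by positivity)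
    ?_ l fun n => ?_
  · rw [inv_pow, mul_inv_lt_iff₀ (by positivity), one_mul]
    exact_mod_cast hlt
  · have h : (a (l + n) : ℝ) ≤ a l * a n := by exact_mod_cast hsub l n
    calc (a (l + n) : ℝ) * ((s : ℝ)⁻¹) ^ (l + n)
        ≤ (a l * a n) * ((s : ℝ)⁻¹) ^ (l + n) := by gcongr
      _ = _ := by rw [pow_add]; ring

/-- The recursive inequalities, weighted by powers of `s⁻¹` and summed up, telescope to
`1 ≤ t R(s⁻¹) / s ^ l`; so equality in the latter means equality in all of them. -/
lemma eq_div_tsum_iff (hs : 0 < s) (hl : 1 ≤ l) (hlow : ∀ n < l, a n = s ^ n)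
    (hrec : ∀ m, s * a (m + l - 1) ≤ a (m + l) + t * a m)
    (hsum : Summable fun n => (a n : ℝ) * ((s : ℝ)⁻¹) ^ n) :
    (t : ℝ) = (s : ℝ) ^ l / ∑' n, (a n : ℝ) * ((s : ℝ)⁻¹) ^ n ↔
      ∀ m, a (m + l) + t * a m = s * a (m + l - 1) := by
  obtain ⟨q, rfl⟩ : ∃ q, l = q + 1 := ⟨l - 1, by omega⟩
  have hs' : (0 : ℝ) < s := by exact_mod_cast hs
  set b : ℕ → ℝ := fun n => (a n : ℝ) * ((s : ℝ)⁻¹) ^ n with hb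
  have hb0 : b 0 = 1 := by simp [hb, hlow 0 hl]
  have hbq : b q = 1 := by
    simp only [hb, hlow q (Nat.lt_succ_self q)]
    push_cast
    rw [← mul_pow, mul_inv_cancel₀ hs'.ne', one_pow]
  have hpos : 0 < ∑' n, b n :=
    hsum.tsum_pos (fun n => by positivity) 0 (by rw [hb0]; exact one_pos)
  have hsum1 := (hasSum_nat_add_iff' q).2 hsum.hasSum
  have hsum2 := (hasSum_nat_add_iff' (q + 1)).2 hsum.hasSum
  have htel := (hsum2.add (hsum.hasSum.mul_left (t * ((s : ℝ)⁻¹) ^ (q + 1)))).sub hsum1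
  have hval : ∀ m, b (m + (q + 1)) + t * ((s : ℝ)⁻¹) ^ (q + 1) * b m - b (m + q) =
      ((a (m + (q + 1)) + t * a m : ℝ) - s * a (m + q)) * ((s : ℝ)⁻¹) ^ (m + (q + 1)) := by
    intro m
    have : ((s : ℝ)⁻¹) ^ (m + q) = s * ((s : ℝ)⁻¹) ^ (m + (q + 1)) := by
      rw [← add_assoc, pow_succ]
      field_simp
    simp only [hb, this]
    rw [pow_add (s : ℝ)⁻¹ m (q + 1)]
    ring
  have hrec' : ∀ m, (0 : ℝ) ≤ (a (m + (q + 1)) + t * a m : ℝ) - s * a (m + q) := by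
    intro m
    have : ((s * a (m + q) : ℕ) : ℝ) ≤ ((a (m + (q + 1)) + t * a m : ℕ) : ℝ) :=
      Nat.cast_le.2 (hrec m)
    push_cast at this
    linarith
  -- the telescoping sum of the nonnegative defects of the inequalities
  have hiff : (t : ℝ) * ((s : ℝ)⁻¹) ^ (q + 1) * (∑' n, b n) = 1 ↔
      ∀ m, a (m + (q + 1)) + t * a m = s * a (m + q) := by
    have hnonneg : ∀ m, 0 ≤ b (m + (q + 1)) + t * ((s : ℝ)⁻¹) ^ (q + 1) * b m - b (m + q) := by
      intro m
      rw [hval]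
      exact mul_nonneg (hrec' m) (by positivity)
    have hzero := hasSum_zero_iff_of_nonneg (L := SummationFilter.unconditional ℕ) hnonneg
    have hlim : ((∑' n, b n) - ∑ i ∈ Finset.range (q + 1), b i) +
        t * ((s : ℝ)⁻¹) ^ (q + 1) * (∑' n, b n) - ((∑' n, b n) - ∑ i ∈ Finset.range q, b i) =
        t * ((s : ℝ)⁻¹) ^ (q + 1) * (∑' n, b n) - 1 := by
      rw [Finset.sum_range_succ, hbq]
      ring
    rw [hlim] at htel
    rw [← sub_eq_zero]
    constructor
    · intro h m
      rw [h] at htel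
      have hm := congrFun (hzero.1 htel) m
      rw [hval] at hm
      have := (mul_eq_zero.1 hm).resolve_right (by positivity)
      have : ((a (m + (q + 1)) + t * a m : ℕ) : ℝ) = ((s * a (m + q) : ℕ) : ℝ) := by
        push_cast
        linarith
      exact_mod_cast this
    · intro h
      refine htel.unique (hzero.2 (funext fun m => ?_))
      have : ((a (m + (q + 1)) + t * a m : ℕ) : ℝ) = ((s * a (m + q) : ℕ) : ℝ) := by rw [h m]
      push_cast at this
      rw [hval, this, sub_self, zero_mul]
      rfl
  refine Iff.trans ?_ hiff
  rw [eq_div_iff hpos.ne', inv_pow, mul_right_comm, ← div_eq_mul_inv,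
    div_eq_one_iff_eq (by positivity)]

/-- A component `a m = 0` forces all later ones to vanish, so the indices at which the quotient is
not meaningful impose no condition. -/
lemma forall_eq_div_iff (hl : 1 ≤ l) (hsucc : ∀ n, a (n + 1) ≤ s * a n) :
    (∀ n, l ≤ n → a (n - l) ≠ 0 →
      (t : ℝ) = ((s : ℝ) * (a (n - 1) : ℝ) - (a n : ℝ)) / (a (n - l) : ℝ)) ↔
      ∀ m, a (m + l) + t * a m = s * a (m + l - 1) := by
  have hvanish : ∀ m, a m = 0 → ∀ i, a (m + i) = 0 := by
    intro m hm i
    induction i with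
    | zero => exact hm
    | succ i ih => simpa [ih, add_assoc] using hsucc (m + i)
  constructor
  · intro h m
    by_cases hm : a m = 0
    · rw [Nat.add_sub_assoc hl, hvanish m hm, hvanish m hm, hm, mul_zero, mul_zero, add_zero]
    · have := h (m + l) (by omega) (by simpa using hm)
      rw [Nat.add_sub_cancel, eq_div_iff (by exact_mod_cast hm)] at this
      have : ((a (m + l) + t * a m : ℕ) : ℝ) = ((s * a (m + l - 1) : ℕ) : ℝ) := by
        push_cast
        linarith
      exact_mod_cast this
  · intro h n hn hne
    rw [eq_div_iff (by exact_mod_cast hne)]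
    have := h (n - l)
    rw [Nat.sub_add_cancel hn] at this
    have : ((a n + t * a (n - l) : ℕ) : ℝ) = ((s * a (n - 1) : ℕ) : ℝ) := by rw [this]
    push_cast at this
    linarith

/-- Comparison of coefficients: those of degree below `l` agree because the sequence starts as in
the free algebra. -/
lemma mk_mul_eq_one_iff (hl : 1 ≤ l) (hlow : ∀ n < l, a n = s ^ n) :
    (PowerSeries.mk fun n => (a n : ℤ)) * (1 - (s : PowerSeries ℤ) * PowerSeries.X +
      (t : PowerSeries ℤ) * PowerSeries.X ^ l) = 1 ↔
      ∀ m, a (m + l) + t * a m = s * a (m + l - 1) := by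
  have hexp : (PowerSeries.mk fun n => (a n : ℤ)) * (1 - (s : PowerSeries ℤ) * PowerSeries.X +
      (t : PowerSeries ℤ) * PowerSeries.X ^ l) = (PowerSeries.mk fun n => (a n : ℤ)) -
      PowerSeries.C (s : ℤ) * ((PowerSeries.mk fun n => (a n : ℤ)) * PowerSeries.X) +
      PowerSeries.C (t : ℤ) * ((PowerSeries.mk fun n => (a n : ℤ)) * PowerSeries.X ^ l) := by
    simp only [map_natCast]
    ring
  rw [hexp, PowerSeries.ext_iff]
  simp only [map_add, map_sub, PowerSeries.coeff_C_mul, PowerSeries.coeff_mul_X_pow',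
    PowerSeries.coeff_mk, PowerSeries.coeff_one]
  constructor
  · intro h m
    have := h (m + (l - 1) + 1)
    rw [PowerSeries.coeff_succ_mul_X, PowerSeries.coeff_mk, if_pos (by omega),
      if_neg (by omega), show m + (l - 1) + 1 = m + l by omega, Nat.add_sub_cancel] at this
    rw [Nat.add_sub_assoc hl]
    zify
    linarith
  · intro h n
    obtain _ | p := n
    · simp [hlow 0 hl, show ¬ l = 0 by omega]
    · rw [PowerSeries.coeff_succ_mul_X, PowerSeries.coeff_mk, if_neg (Nat.succ_ne_zero p)]
      split_ifs with hp
      · have := h (p + 1 - l)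
        rw [Nat.sub_add_cancel hp, Nat.add_sub_cancel] at this
        zify at this
        linarith
      · rw [hlow _ (by omega), hlow _ (by omega)]
        push_cast
        ring

end Series

section Algebra

/-! ### The set of relations and its generating function -/

variable {k : Type*} [Field k] {s : ℕ}

lemma zero_notMem_of_isMinimalGenerating {α : Set (FreeAlgebra k (Fin s))}
    (h : IsMinimalGenerating α) : (0 : FreeAlgebra k (Fin s)) ∉ α := by
  intro h0
  refine h (α \ {0}) ⟨Set.sdiff_subset, fun h' => (h' h0).2 rfl⟩ ?_
  refine le_antisymm (TwoSidedIdeal.span_mono Set.sdiff_subset) (TwoSidedIdeal.span_le.2 ?_)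
  intro f hf
  by_cases hf0 : f = 0
  · rw [hf0]
    exact TwoSidedIdeal.zero_mem _
  · exact TwoSidedIdeal.subset_span ⟨hf, hf0⟩

/-- All relations have degree `l`: the component of degree `l` contains all of `α`, and any other
component meets it trivially, since `0 ∉ α`. -/
lemma genFun_eq {l : ℕ} (α : Finset (FreeAlgebra k (Fin s)))
    (hdeg : ∀ f ∈ α, f ∈ homogeneousPart k s l) (h0 : (0 : FreeAlgebra k (Fin s)) ∉ α) :
    genFun (α : Set (FreeAlgebra k (Fin s))) =
      (α.card : PowerSeries ℤ) * PowerSeries.X ^ l := by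
  ext n
  rw [genFun, PowerSeries.coeff_mk, ← map_natCast (PowerSeries.C (R := ℤ)),
    PowerSeries.coeff_C_mul, PowerSeries.coeff_X_pow]
  split_ifs with hn
  · subst hn
    rw [Set.inter_eq_left.2 hdeg, Set.ncard_coe_finset]
    simp
  · have : (α : Set (FreeAlgebra k (Fin s))) ∩ (homogeneousPart k s n : Set _) = ∅ := by
      refine Set.eq_empty_of_forall_notMem fun f hf => h0 ?_
      rw [← eq_zero_of_mem_homogeneousPart hn hf.2 (hdeg f hf.1)]
      exact hf.1
    simp [this]

end Algebra

end GolodShafarevich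

theorem mainTheorem3 {k : Type*} [Field k] (s l t : ℕ) (hl : 1 ≤ l) (ht : 0 < t)
    (α : Finset (FreeAlgebra k (Fin s))) (hcard : α.card = t)
    (hdeg : ∀ f ∈ α, f ∈ GolodShafarevich.homogeneousPart k s l)
    (hmin : GolodShafarevich.IsMinimalGenerating (α : Set (FreeAlgebra k (Fin s)))) :
    Summable (fun n : ℕ =>
      (GolodShafarevich.dimPart (α : Set (FreeAlgebra k (Fin s))) n : ℝ) * ((s : ℝ)⁻¹) ^ n) ∧
    List.TFAE [
      GolodShafarevich.StronglyFree (α : Set (FreeAlgebra k (Fin s))),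
      (t : ℝ) = (s : ℝ) ^ l /
        ∑' n : ℕ,
          (GolodShafarevich.dimPart (α : Set (FreeAlgebra k (Fin s))) n : ℝ) * ((s : ℝ)⁻¹) ^ n,
      ∀ n : ℕ, l ≤ n → GolodShafarevich.dimPart (α : Set (FreeAlgebra k (Fin s))) (n - l) ≠ 0 →
        (t : ℝ) =
          ((s : ℝ) * (GolodShafarevich.dimPart (α : Set (FreeAlgebra k (Fin s))) (n - 1) : ℝ)
            - (GolodShafarevich.dimPart (α : Set (FreeAlgebra k (Fin s))) n : ℝ)) /
          (GolodShafarevich.dimPart (α : Set (FreeAlgebra k (Fin s))) (n - l) : ℝ)] := by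
  open GolodShafarevich in
  subst hcard
  obtain ⟨f, hf⟩ := Finset.card_pos.1 ht
  have h0 := zero_notMem_of_isMinimalGenerating hmin
  have hlt := dimPart_lt hdeg hf (fun h => h0 (h ▸ hf))
  -- for `s = 0` the component of positive degree `l` is zero, and has no room for `f`
  have hs : 0 < s := by
    refine Nat.pos_of_ne_zero fun hs => ?_
    have : s ^ l = 0 := by rw [hs, zero_pow (by omega)]
    omega
  have hlow : ∀ n < l, dimPart (α : Set (FreeAlgebra k (Fin s))) n = s ^ n :=
    fun n hn => dimPart_of_lt hdeg hn
  have hsum := summable_of_submultiplicative hs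
    (dimPart_add_le (α : Set (FreeAlgebra k (Fin s)))) hlt
  refine ⟨hsum, ?_⟩
  have h1 := mk_mul_eq_one_iff (t := α.card) hl hlow
  rw [← genFun_eq α hdeg h0] at h1
  replace h1 := (and_iff_right (α.coe_nonempty.2 ⟨f, hf⟩)).trans h1
  have h2 := eq_div_tsum_iff hs hl hlow (mul_dimPart_le α hdeg hl) hsum
  have h3 := forall_eq_div_iff (t := α.card) hl
    (dimPart_succ_le (α : Set (FreeAlgebra k (Fin s))))
  tfae_have 1 ↔ 2 := h1.trans h2.symm
  tfae_have 1 ↔ 3 := h1.trans h3.symm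
  tfae_finish
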